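/- Let $n\ge 3$ be an integer and let $p$ be a prime with $p\equiv 1\pmod n$. For $k\ge 0$ put $(x)_k=x(x+1)\cdots(x+k-1)$, with $(x)_0=1$, and define the truncated hypergeometric series $$ {}_nF_{n-1}\left[\begin{matrix}x_1&x_2&\cdots&x_n\\&y_1&\cdots&y_{n-1}\end{matrix}\,\Big|\,z\right]_{m}=\sum_{k=0}^{m}\frac{(x_1)_k(x_2)_k\cdots(x_n)_k}{(y_1)_k\cdots(y_{n-1})_k}\cdot\frac{z^k}{k!}. $$ Let $\Gamma_p$ denote Morita's $p$-adic Gamma function on the ring $\mathbb Z_p$ of $p$-adic integers, that is, $\Gamma_p(0)=1$, $\Gamma_p(a)=(-1)^a\prod_{1\le k<a,\ (k,p)=1}k$ for integers $a\ge 1$, and $\Gamma_p(x)=\lim_{a\in\mathbb N,\ |x-a|_p\to 0}\Gamma_p(a)$ for $x\in\mathbb Z_p$. Then $\frac1n$ and the truncated series below lie in $\mathbb Z_p$, and $$ {}_nF_{n-1}\left[\begin{matrix}\frac{n-1}{n}&\frac{n-1}{n}&\cdots&\frac{n-1}{n}\\&1&\cdots&1\end{matrix}\,\Big|\,1\right]_{p-1}\equiv-\Gamma_p\left(\frac1n\right)^n\pmod{p^3\mathbb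 Z_p}. $$ -/

import Mathlib

open Filter Topology

/-- The truncated hypergeometric series
`∑_{k=0}^{m} (x₁)_k ⋯ (x_r)_k / ((y₁)_k ⋯ (y_s)_k) · z^k / k!`,
where `(x)_k = x (x + 1) ⋯ (x + k - 1)` is the rising factorial. -/
noncomputable def truncatedHypergeometric {K : Type*} [Field K] {r s : ℕ}
    (x : Fin r → K) (y : Fin s → K) (z : K) (m : ℕ) : K :=
  ∑ k ∈ Finset.range (m + 1),
    (∏ i, (ascPochhammer K k).eval (x i)) / (∏ j, (ascPochhammer K k).eval (y j)) *
      (z ^ k / (k.factorial : K))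

/-- Morita's `p`-adic Gamma function at a natural number:
`Γ_p(n) = (-1)^n ∏_{1 ≤ k < n, (k, p) = 1} k`, so that `Γ_p(0) = 1`. -/
noncomputable def padicGammaNat (p : ℕ) [Fact p.Prime] (n : ℕ) : ℤ_[p] :=
  (-1) ^ n * ∏ k ∈ (Finset.Ico 1 n).filter (fun k => k.Coprime p), (k : ℤ_[p])

/-- Morita's `p`-adic Gamma function on `ℤ_p`: the limit of `Γ_p(n)` as the natural number `n`
tends to `x` in the `p`-adic topology. -/
noncomputable def padicGamma (p : ℕ) [Fact p.Prime] (x : ℤ_[p]) : ℤ_[p] :=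
  limUnder (comap (fun n : ℕ => (n : ℤ_[p])) (𝓝 x)) (padicGammaNat p)

/-!
Write `p = nm + 1`, `r = n - 1`, `N = rm`, `u = 1/n`, and `H k = ∑_{j=1}^k j⁻²`. The numerators of the
series have the upper parameter `1 - 1/n = m + 1 - p/n = -N + p (1 - 1/n)`, so its terms with `k > N`
vanish modulo `p³`. Modulo `p³` the product of `n` equal factors `M - p/n` agrees with
`M^(n-1) (M - p)` up to the factor `1 + p² (1 - u)/2 · M⁻²` (`sub_mul_pow_eq`). Hence for `k ≤ N` the
`k`-th term is `U k * (1 + p² (1 - u)/2 · (H (k + m) - H m))`, with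
`U k = (-1)^k C(N, k) C(k + m, m)^r` (`prod_pow_eq_mintonWeight_mul`).

The numbers `U k` are the terms of a Karlsson–Minton sum, which is nothing but the `N`-th difference
of a monic polynomial of degree `N`. Deforming that polynomial by `p² y` gives
`m!^r ∑ U k (1 - p² y (H (k + m) - H k)) ≡ (-1)^N N!` (`factorial_pow_mul_sum_mintonWeight_eq`). The
remaining input is the symmetry `k ↦ N - k`, which shows `∑ U k (H (k + m) + H k) ≡ 0 (mod p)`. With
`y = -(1 - u)/4` these combine to `m!^r S ≡ (-1)^N N! (1 - p² (1 - u)/2 · H m)` for the series `S`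
(`ZMod.factorial_pow_mul_sum_prod_pow_eq`).

On the Gamma side, Wilson's theorem modulo prime powers makes `Γ_p` a `1`-Lipschitz function, so it
may be evaluated at a natural number `a = pb - m ≡ 1/n (mod p³)`, where `b ≡ 1/n (mod p³)`. By a
Wolstenholme type congruence `Γ_p(pb) ≡ (-(p - 1)!)^b (mod p³)`, and the functional equation relates
`Γ_p(pb)` to `Γ_p(a)` through `∏_{j=1}^m (j - pb)`, whose `n`-th power is again given by
`sub_mul_pow_eq`. The result is
`m!^r Γ_p(1/n)^n (1 + p² (1 - u)/2 · H m) ≡ -(-1)^m N!` (`ZMod.factorial_pow_mul_gammaProd_pow_eq`).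
As `N + m = p - 1` is even, comparison of the two evaluations proves the congruence.

Inverses of `1, …, p - 1` in a ring are carried along as a function `w` with `j * w j = 1` for
`0 < j < p`, so that all the congruences become identities in rings in which `p³ = 0` or `p = 0`.
-/

/-! ### Expansions modulo nilpotents -/

theorem prod_one_add_mul_of_mul_self_eq_zero {R ι : Type*} [CommRing R] {z : R} (hz : z * z = 0)
    (s : Finset ι) (f : ι → R) : ∏ i ∈ s, (1 + z * f i) = 1 + z * ∑ i ∈ s, f i := by
  classical
  induction s using Finset.induction_on with
  | empty => simp
  | insert a s ha ih =>
    rw [Finset.prod_insert ha, Finset.sum_insert ha, ih]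
    linear_combination (f a * ∑ i ∈ s, f i) * hz

theorem one_sub_pow_of_cube_eq_zero {R : Type*} [CommRing R] {z : R} (hz : z ^ 3 = 0) (n : ℕ) :
    (1 - z) ^ n = 1 - n * z + n.choose 2 * z ^ 2 := by
  induction n with
  | zero => simp
  | succ n ih =>
    rw [pow_succ, ih, Nat.choose_succ_succ' n 1]
    push_cast [Nat.choose_one_right]
    linear_combination (-(n.choose 2 : R)) * hz

/-- With `n = r + 1`, `n u = 1` and `W = M⁻¹`: modulo `q³`, replacing the `n` equal factors
`M - q / n` by `n - 1` factors `M` and one factor `M - q` preserves the linear term in `q`, and costs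
only the quadratic correction `1 + q² (1 - 1 / n) / 2 · M⁻²`. Here `h` stands for `1 / 2`. -/
theorem sub_mul_pow_eq {R : Type*} [CommRing R] {q u h M W : R} {r : ℕ} (hq : q ^ 3 = 0)
    (hu : ((r + 1 : ℕ) : R) * u = 1) (hh : 2 * h = 1) (hM : M * W = 1) :
    (M - q * u) ^ (r + 1) = M ^ r * (M - q) * (1 + q ^ 2 * ((1 - u) * h * W ^ 2)) := by
  have e1 : M - q * u = M * (1 - q * u * W) := by linear_combination q * u * hM
  have hz : (q * u * W) ^ 3 = 0 := by rw [mul_pow, mul_pow, hq]; ring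
  have hc : 2 * ((r + 1).choose 2 : R) = ((r + 1 : ℕ) : R) * r := by
    have h2 : 2 * (r + 1).choose 2 = (r + 1) * r := by
      rw [Nat.choose_two_right, Nat.add_sub_cancel, Nat.mul_div_cancel']
      exact (Nat.even_mul_pred_self (r + 1)).two_dvd
    exact_mod_cast congrArg (Nat.cast (R := R)) h2
  rw [e1, mul_pow, one_sub_pow_of_cube_eq_zero hz]
  have hc' : ((r + 1).choose 2 : R) * u ^ 2 = (1 - u) * h := by
    have hu' : (r : R) * u = 1 - u := by push_cast at hu; linear_combination hu
    linear_combination (-((r + 1).choose 2 : R) * u ^ 2) * hh + (h * u ^ 2) * hc +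
      (h * r * u) * hu + h * hu'
  have e2 : M - q = M * (1 - q * W) := by linear_combination q * hM
  rw [e2]
  push_cast at hu ⊢
  rw [pow_succ]
  linear_combination (-(M ^ r * M * q * W)) * hu + (M ^ r * M * q ^ 2 * W ^ 2) * hc' +
    (M ^ r * M * W * (1 - u) * h * W ^ 2) * hq

/-! ### The summation formula -/

/-- The `N`-th finite difference of a monic polynomial of degree `N` is `N!`. -/
theorem sum_neg_one_pow_mul_choose_mul_eval_eq {R : Type*} [CommRing R] {P : Polynomial R}
    (hP : P.Monic) : ∑ k ∈ Finset.range (P.natDegree + 1),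
      (-1) ^ k * (P.natDegree.choose k : R) * P.eval (k : R) =
        (-1) ^ P.natDegree * (P.natDegree.factorial : R) := by
  have h := congrFun (Polynomial.fwdDiff_iter_degree_eq_factorial P) 0
  rw [fwdDiff_iter_eq_sum_shift, hP.leadingCoeff] at h
  simp only [one_smul, Pi.natCast_apply] at h
  rw [← h, Finset.mul_sum]
  refine Finset.sum_congr rfl fun k hk => ?_
  have hk' : k ≤ P.natDegree := by simpa [Nat.lt_succ_iff] using hk
  have hs : (-1 : R) ^ k = (-1) ^ P.natDegree * (-1) ^ (P.natDegree - k) := by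
    rw [← pow_add, show P.natDegree + (P.natDegree - k) = k + 2 * (P.natDegree - k) by omega,
      pow_add, pow_mul]
    simp
  rw [hs]
  simp [mul_assoc]

/-- The Karlsson–Minton summation in the form needed here, namely the `N`-th difference at `0` of
`((x + 1) ⋯ (x + m)) ^ s * ∏_{j=1}^m ((x + j)² - y)`, with `N = (s + 2) m`. In hypergeometric terms
two of the lower parameters are `1 ± √y` and the others are `1`; only `y` itself enters, so no
square root is needed. -/
theorem sum_choose_mul_prod_sq_sub_eq {R : Type*} [CommRing R] (m s : ℕ) (y : R) :
    ∑ k ∈ Finset.range ((s + 2) * m + 1), (-1) ^ k * (((s + 2) * m).choose k : R) *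
      ((∏ j ∈ Finset.range m, ((k + j + 1 : ℕ) : R)) ^ s *
        ∏ j ∈ Finset.range m, (((k + j + 1 : ℕ) : R) ^ 2 - y)) =
      (-1) ^ ((s + 2) * m) * (((s + 2) * m).factorial : R) := by
  nontriviality R
  let A : Polynomial R := ∏ j ∈ Finset.range m, (Polynomial.X + Polynomial.C ((j + 1 : ℕ) : R))
  let q : ℕ → Polynomial R := fun j =>
    (Polynomial.X + Polynomial.C ((j + 1 : ℕ) : R)) ^ 2 - Polynomial.C y
  let B : Polynomial R := ∏ j ∈ Finset.range m, q j
  have hA : A.Monic := Polynomial.monic_prod_of_monic _ _ fun j _ => Polynomial.monic_X_add_C _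
  have hAd : A.natDegree = m := by
    rw [Polynomial.natDegree_prod_of_monic _ _ fun j _ => Polynomial.monic_X_add_C _]
    simp only [Polynomial.natDegree_X_add_C, Finset.sum_const, Finset.card_range, smul_eq_mul,
      mul_one]
  have hq2 (j : ℕ) : ((Polynomial.X + Polynomial.C ((j + 1 : ℕ) : R)) ^ 2).natDegree = 2 := by
    rw [(Polynomial.monic_X_add_C _).natDegree_pow, Polynomial.natDegree_X_add_C]
  have hlt (j : ℕ) : (Polynomial.C y).degree <
      ((Polynomial.X + Polynomial.C ((j + 1 : ℕ) : R)) ^ 2).degree := by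
    refine lt_of_le_of_lt Polynomial.degree_C_le ?_
    rw [Polynomial.degree_eq_natDegree ((Polynomial.monic_X_add_C _).pow 2).ne_zero, hq2]
    norm_num
  have hq (j : ℕ) : (q j).Monic := ((Polynomial.monic_X_add_C _).pow 2).sub_of_left (hlt j)
  have hqd (j : ℕ) : (q j).natDegree = 2 := by
    rw [← hq2 j]
    exact Polynomial.natDegree_sub_C
  have hB : B.Monic := Polynomial.monic_prod_of_monic _ _ fun j _ => hq j
  have hBd : B.natDegree = 2 * m := by
    rw [Polynomial.natDegree_prod_of_monic _ _ fun j _ => hq j]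
    simp [hqd, mul_comm]
  have hP : (A ^ s * B).Monic := (hA.pow s).mul hB
  have hd : (A ^ s * B).natDegree = (s + 2) * m := by
    rw [(hA.pow s).natDegree_mul hB, hA.natDegree_pow, hAd, hBd]; ring
  have := sum_neg_one_pow_mul_choose_mul_eval_eq hP
  rw [hd] at this
  rw [← this]
  refine Finset.sum_congr rfl fun k _ => ?_
  simp only [A, B, q, Polynomial.eval_mul, Polynomial.eval_pow, Polynomial.eval_prod,
    Polynomial.eval_sub, Polynomial.eval_add, Polynomial.eval_X, Polynomial.eval_C]
  push_cast
  simp only [add_assoc]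

/-! ### Sums of inverse squares and weighted sums -/

/-- `∑_{j=1}^{k} j⁻²`, where `w` is a choice of inverses `w j = j⁻¹`. -/
def harmonicSq {R : Type*} [CommRing R] (w : ℕ → R) (k : ℕ) : R :=
  ∑ j ∈ Finset.range k, w (j + 1) ^ 2

/-- The weight `(-1)^k C(rm, k) C(k + m, m)^r` of the Karlsson–Minton sum, as an element of `R`. -/
def mintonWeight (R : Type*) [CommRing R] (m r k : ℕ) : R :=
  (-1) ^ k * ((r * m).choose k : R) * ((k + m).choose m : R) ^ r

theorem harmonicSq_add {R : Type*} [CommRing R] (w : ℕ → R) (k m : ℕ) :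
    harmonicSq w (k + m) = harmonicSq w k + ∑ j ∈ Finset.range m, w (k + j + 1) ^ 2 := by
  simp only [harmonicSq, Finset.sum_range_add]

theorem prod_range_natCast_add_eq {R : Type*} [CommRing R] (k m : ℕ) :
    ∏ j ∈ Finset.range m, ((k + j + 1 : ℕ) : R) = (m.factorial : R) * ((k + m).choose m : R) := by
  rw [← Nat.cast_prod, ← Nat.cast_mul, ← Nat.ascFactorial_eq_factorial_mul_choose,
    Nat.ascFactorial_eq_prod_range]
  congr 1
  exact Finset.prod_congr rfl fun j _ => by ring

/-- The Karlsson–Minton sum modulo `p³`, with deformation parameter `p² y`. -/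
theorem factorial_pow_mul_sum_mintonWeight_eq {R : Type*} [CommRing R] {m r p : ℕ} {w : ℕ → R}
    (hr : 2 ≤ r) (hp : p = r * m + m + 1) (hw : ∀ j, 0 < j → j < p → (j : R) * w j = 1)
    (hp3 : (p : R) ^ 3 = 0) (y : R) :
    (m.factorial : R) ^ r * ∑ k ∈ Finset.range (r * m + 1), mintonWeight R m r k *
      (1 - (p : R) ^ 2 * y * (harmonicSq w (k + m) - harmonicSq w k)) =
      (-1) ^ (r * m) * ((r * m).factorial : R) := by
  obtain ⟨s, rfl⟩ := Nat.exists_eq_add_of_le' hr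
  rw [← sum_choose_mul_prod_sq_sub_eq m s ((p : R) ^ 2 * y), Finset.mul_sum]
  refine Finset.sum_congr rfl fun k hk => ?_
  rw [Finset.mem_range] at hk
  have hz : (p : R) ^ 2 * (p : R) ^ 2 = 0 := by linear_combination (p : R) * hp3
  have e : ∏ j ∈ Finset.range m, (((k + j + 1 : ℕ) : R) ^ 2 - (p : R) ^ 2 * y) =
      (∏ j ∈ Finset.range m, ((k + j + 1 : ℕ) : R)) ^ 2 *
        (1 - (p : R) ^ 2 * y * (harmonicSq w (k + m) - harmonicSq w k)) := by
    have e1 : 1 - (p : R) ^ 2 * y * (harmonicSq w (k + m) - harmonicSq w k) =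
        1 + (p : R) ^ 2 * ∑ j ∈ Finset.range m, (-y * w (k + j + 1) ^ 2) := by
      rw [harmonicSq_add, ← Finset.mul_sum]; ring
    rw [e1, ← prod_one_add_mul_of_mul_self_eq_zero hz, ← Finset.prod_pow,
      ← Finset.prod_mul_distrib]
    refine Finset.prod_congr rfl fun j hj => ?_
    rw [Finset.mem_range] at hj
    have hwj := hw (k + j + 1) (by omega) (by omega)
    linear_combination ((p : R) ^ 2 * y * (((k + j + 1 : ℕ) : R) * w (k + j + 1) + 1)) * hwj
  rw [e, mintonWeight, prod_range_natCast_add_eq]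
  ring

theorem inverse_family_eq_neg {p : ℕ} [Fact p.Prime] {w : ℕ → ZMod p}
    (hw : ∀ j, 0 < j → j < p → (j : ZMod p) * w j = 1) {i j : ℕ} (hi : 0 < i) (hj : 0 < j)
    (hij : i + j = p) : w i = -w j := by
  have h1 := hw i hi (by omega)
  have h2 := hw j hj (by omega)
  have h3 : (i : ZMod p) + j = 0 := by rw [← Nat.cast_add, hij, ZMod.natCast_self]
  linear_combination w j * w i * h3 - w j * h1 - w i * h2

theorem sum_range_natCast_zmod {p : ℕ} [NeZero p] {A : Type*} [AddCommMonoid A] (f : ZMod p → A) :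
    ∑ j ∈ Finset.range p, f (j : ZMod p) = ∑ x : ZMod p, f x := by
  refine Finset.sum_bij' (fun j _ => (j : ZMod p)) (fun x _ => x.val) ?_ ?_ ?_ ?_ ?_
  · simp
  · intro x _; simpa using ZMod.val_lt x
  · intro j hj; exact ZMod.val_cast_of_lt (by simpa using hj)
  · intro x _; simp
  · simp

theorem harmonicSq_sub_one_eq_zero {p : ℕ} [Fact p.Prime] (hp : 5 ≤ p) {w : ℕ → ZMod p}
    (hw : ∀ j, 0 < j → j < p → (j : ZMod p) * w j = 1) : harmonicSq w (p - 1) = 0 := by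
  have h := FiniteField.sum_pow_lt_card_sub_one (K := ZMod p) (p - 3)
    (by rw [ZMod.card]; omega)
  rw [← sum_range_natCast_zmod (fun x : ZMod p => x ^ (p - 3)),
    show Finset.range p = Finset.range (p - 1 + 1) by rw [Nat.sub_add_cancel (by omega)],
    Finset.sum_range_succ', Nat.cast_zero, zero_pow (by omega), add_zero] at h
  rw [← h, harmonicSq]
  refine Finset.sum_congr rfl fun j hj => ?_
  rw [Finset.mem_range] at hj
  have hwj := hw (j + 1) (by omega) (by omega)
  have hne : ((j + 1 : ℕ) : ZMod p) ≠ 0 := left_ne_zero_of_mul_eq_one hwj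
  have hf := ZMod.pow_card_sub_one_eq_one hne
  rw [show p - 1 = p - 3 + 2 by omega, pow_add] at hf
  linear_combination (-(w (j + 1)) ^ 2) * hf + (((j + 1 : ℕ) : ZMod p) ^ (p - 3) *
    (((j + 1 : ℕ) : ZMod p) * w (j + 1) + 1)) * hwj

/-- For `k + l = p - 1` the substitution `j ↦ p - j` gives `∑_{j≤l} j⁻² ≡ -∑_{j≤k} j⁻² (mod p)`. -/
theorem harmonicSq_reflect {p : ℕ} [Fact p.Prime] (hp : 5 ≤ p) {w : ℕ → ZMod p}
    (hw : ∀ j, 0 < j → j < p → (j : ZMod p) * w j = 1) {k l : ℕ} (hkl : k + l + 1 = p) :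
    harmonicSq w l = -harmonicSq w k := by
  induction k generalizing l with
  | zero =>
    rw [show l = p - 1 by omega, harmonicSq_sub_one_eq_zero hp hw]
    simp [harmonicSq]
  | succ k ih =>
    have h := ih (l := l + 1) (by omega)
    have e := inverse_family_eq_neg hw (i := k + 1) (j := l + 1) (by omega) (by omega)
      (by omega)
    simp only [harmonicSq, Finset.sum_range_succ] at h ⊢
    rw [e]
    linear_combination h

/-- Modulo `p = (r + 1) m + 1` the weights are symmetric under `k ↦ rm - k`. -/
theorem mintonWeight_reflect {p m r k l : ℕ} [Fact p.Prime] (hp : p = r * m + m + 1)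
    (hkl : k + l = r * m) : mintonWeight (ZMod p) m r l = mintonWeight (ZMod p) m r k := by
  have hp0 : ((r * m + m + 1 : ℕ) : ZMod p) = 0 := by rw [← hp, ZMod.natCast_self]
  have hm : (m.factorial : ZMod p) ≠ 0 := by
    rw [Ne, ZMod.natCast_eq_zero_iff, (Fact.out : p.Prime).dvd_factorial]
    omega
  have hc : ((l + m).choose m : ZMod p) = (-1) ^ m * ((k + m).choose m : ZMod p) := by
    apply mul_left_cancel₀ hm
    rw [← prod_range_natCast_add_eq, mul_left_comm, ← prod_range_natCast_add_eq,
      ← Finset.prod_range_reflect]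
    have : ((-1 : ZMod p)) ^ m = ∏ j ∈ Finset.range m, (-1 : ZMod p) := by simp
    rw [this, ← Finset.prod_mul_distrib]
    refine Finset.prod_congr rfl fun j hj => ?_
    rw [Finset.mem_range] at hj
    have : (l + (m - 1 - j) + 1) + (k + j + 1) = r * m + m + 1 := by omega
    have h2 := congrArg (Nat.cast (R := ZMod p)) this
    rw [hp0, Nat.cast_add] at h2
    linear_combination h2
  have hch : (r * m).choose l = (r * m).choose k := by
    rw [← Nat.choose_symm (by omega : k ≤ r * m)]
    congr 1; omega
  have hs : (-1 : ZMod p) ^ l * ((-1) ^ m) ^ r = (-1) ^ k := by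
    rw [← pow_mul, ← pow_add, show l + m * r = k + 2 * l by rw [mul_comm m r]; omega, pow_add,
      pow_mul]
    simp
  rw [mintonWeight, mintonWeight, hc, hch, mul_pow, ← hs]
  ring

/-- The reflection `k ↦ rm - k` preserves the weight and exchanges `k + m` with `p - 1 - k`, so it
changes the sign of the sum. -/
theorem sum_mintonWeight_mul_harmonicSq_eq_zero {p m r : ℕ} [Fact p.Prime] (h5 : 5 ≤ p)
    {w : ℕ → ZMod p} (hp : p = r * m + m + 1)
    (hw : ∀ j, 0 < j → j < p → (j : ZMod p) * w j = 1) :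
    ∑ k ∈ Finset.range (r * m + 1), mintonWeight (ZMod p) m r k *
      (harmonicSq w (k + m) + harmonicSq w k) = 0 := by
  set S := ∑ k ∈ Finset.range (r * m + 1), mintonWeight (ZMod p) m r k *
      (harmonicSq w (k + m) + harmonicSq w k) with hS
  have h : S = -S := by
    conv_lhs => rw [hS, ← Finset.sum_range_reflect]
    rw [hS, ← Finset.sum_neg_distrib]
    refine Finset.sum_congr rfl fun k hk => ?_
    rw [Finset.mem_range] at hk
    have e : k + (r * m + 1 - 1 - k) = r * m := by omega
    rw [mintonWeight_reflect hp e, harmonicSq_reflect h5 hw (k := k) (by omega),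
      harmonicSq_reflect h5 hw (k := k + m) (l := r * m + 1 - 1 - k) (by omega)]
    ring
  have h2 : (2 : ZMod p) ≠ 0 := by
    have : ((2 : ℕ) : ZMod p) ≠ 0 := by
      rw [Ne, ZMod.natCast_eq_zero_iff]
      exact fun h => by have := Nat.le_of_dvd (by norm_num) h; omega
    exact_mod_cast this
  exact (mul_eq_zero.mp (by linear_combination h : (2 : ZMod p) * S = 0)).resolve_left h2

/-! ### The truncated series modulo `p³` -/

theorem ZMod.sq_mul_eq_zero_of_castHom_eq_zero {p : ℕ} [NeZero p] {x : ZMod (p ^ 3)}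
    (hx : ZMod.castHom (dvd_pow_self p three_ne_zero) (ZMod p) x = 0) :
    (p : ZMod (p ^ 3)) ^ 2 * x = 0 := by
  have : NeZero (p ^ 3) := ⟨pow_ne_zero _ (NeZero.ne p)⟩
  rw [← ZMod.natCast_zmod_val x, map_natCast, ZMod.natCast_eq_zero_iff] at hx
  obtain ⟨c, hc⟩ := hx
  rw [← ZMod.natCast_zmod_val x, hc, ← Nat.cast_pow, ← Nat.cast_mul, ZMod.natCast_eq_zero_iff]
  exact ⟨c, by ring⟩

theorem map_harmonicSq {R K : Type*} [CommRing R] [CommRing K] (φ : R →+* K) (w : ℕ → R) (k : ℕ) :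
    φ (harmonicSq w k) = harmonicSq (fun j => φ (w j)) k := by
  simp [harmonicSq]

theorem map_mintonWeight {R K : Type*} [CommRing R] [CommRing K] (φ : R →+* K) (m r k : ℕ) :
    φ (mintonWeight R m r k) = mintonWeight K m r k := by
  simp [mintonWeight]

theorem map_inverse_family {R K : Type*} [CommRing R] [CommRing K] (φ : R →+* K) {p : ℕ}
    {w : ℕ → R} (hw : ∀ j, 0 < j → j < p → (j : R) * w j = 1) :
    ∀ j, 0 < j → j < p → (j : K) * φ (w j) = 1 := fun j h0 h1 => by
  rw [← map_natCast φ, ← map_mul, hw j h0 h1, map_one]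

theorem ZMod.sq_mul_sum_mintonWeight_mul_harmonicSq_eq_zero {p m r : ℕ} [Fact p.Prime]
    (h5 : 5 ≤ p) {w : ℕ → ZMod (p ^ 3)} (hp : p = r * m + m + 1)
    (hw : ∀ j, 0 < j → j < p → (j : ZMod (p ^ 3)) * w j = 1) :
    (p : ZMod (p ^ 3)) ^ 2 * ∑ k ∈ Finset.range (r * m + 1), mintonWeight (ZMod (p ^ 3)) m r k *
      (harmonicSq w (k + m) + harmonicSq w k) = 0 := by
  apply ZMod.sq_mul_eq_zero_of_castHom_eq_zero
  simp only [map_sum, map_mul, map_add, map_harmonicSq, map_mintonWeight]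
  exact sum_mintonWeight_mul_harmonicSq_eq_zero h5 hp (map_inverse_family _ hw)

theorem factorial_mul_prod_eq_one {R : Type*} [CommRing R] {p : ℕ} {w : ℕ → R}
    (hw : ∀ j, 0 < j → j < p → (j : R) * w j = 1) {k : ℕ} (hk : k < p) :
    (k.factorial : R) * ∏ j ∈ Finset.range k, w (j + 1) = 1 := by
  rw [← Finset.prod_range_add_one_eq_factorial, Nat.cast_prod, ← Finset.prod_mul_distrib]
  refine Finset.prod_eq_one fun j hj => ?_
  rw [Finset.mem_range] at hj
  exact hw (j + 1) (by omega) (by omega)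

/-- The `k`-th term of the series, for `k ≤ rm`. Since `1 - 1/n = m + 1 - p/n`, its factors are
`m + j + 1 - p/n`, to which `sub_mul_pow_eq` applies. -/
theorem prod_pow_eq_mintonWeight_mul {R : Type*} [CommRing R] {m r p k : ℕ} {w : ℕ → R} {u h : R}
    (hp : p = r * m + m + 1) (hw : ∀ j, 0 < j → j < p → (j : R) * w j = 1)
    (hp3 : (p : R) ^ 3 = 0) (hu : ((r + 1 : ℕ) : R) * u = 1) (hh : 2 * h = 1) (hk : k ≤ r * m) :
    (∏ j ∈ Finset.range k, (1 - u + j) * w (j + 1)) ^ (r + 1) = mintonWeight R m r k *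
      (1 + (p : R) ^ 2 * ((1 - u) * h * (harmonicSq w (k + m) - harmonicSq w m))) := by
  have hz : (p : R) ^ 2 * (p : R) ^ 2 = 0 := by linear_combination (p : R) * hp3
  have hw1 := factorial_mul_prod_eq_one hw (k := k) (by omega)
  have hM : ∏ j ∈ Finset.range k, (((m + j + 1 : ℕ) : R) * w (j + 1)) = ((k + m).choose m : R) := by
    rw [Finset.prod_mul_distrib, prod_range_natCast_add_eq, add_comm m k,
      Nat.choose_symm_add]
    linear_combination ((k + m).choose m : R) * hw1
  have hN : ∏ j ∈ Finset.range k, ((((m + j + 1 : ℕ) : R) - p) * w (j + 1)) =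
      (-1) ^ k * ((r * m).choose k : R) := by
    have e : ∏ j ∈ Finset.range k, (((m + j + 1 : ℕ) : R) - p) =
        (-1) ^ k * ((r * m).descFactorial k : R) := by
      rw [Nat.descFactorial_eq_prod_range, Nat.cast_prod]
      have : ((-1 : R)) ^ k = ∏ j ∈ Finset.range k, (-1 : R) := by simp
      rw [this, ← Finset.prod_mul_distrib]
      refine Finset.prod_congr rfl fun j hj => ?_
      rw [Finset.mem_range] at hj
      rw [Nat.cast_sub (by omega), hp]
      push_cast
      ring
    rw [Finset.prod_mul_distrib, e, Nat.descFactorial_eq_factorial_mul_choose, Nat.cast_mul]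
    linear_combination ((-1) ^ k * ((r * m).choose k : R)) * hw1
  have hH : harmonicSq w (k + m) - harmonicSq w m = ∑ j ∈ Finset.range k, w (m + j + 1) ^ 2 := by
    rw [add_comm k m, harmonicSq_add]; ring
  have hprod : 1 + (p : R) ^ 2 * ((1 - u) * h * (harmonicSq w (k + m) - harmonicSq w m)) =
      ∏ j ∈ Finset.range k, (1 + (p : R) ^ 2 * ((1 - u) * h * w (m + j + 1) ^ 2)) := by
    rw [prod_one_add_mul_of_mul_self_eq_zero hz, hH, Finset.mul_sum]
  rw [mintonWeight, ← hN, ← hM, hprod, ← Finset.prod_pow, ← Finset.prod_pow,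
    ← Finset.prod_mul_distrib, ← Finset.prod_mul_distrib]
  refine Finset.prod_congr rfl fun j hj => ?_
  rw [Finset.mem_range] at hj
  have e : 1 - u + (j : R) = ((m + j + 1 : ℕ) : R) - p * u := by
    have hp' : (p : R) = r * m + m + 1 := by rw [hp]; push_cast; ring
    rw [hp']; push_cast at hu ⊢
    linear_combination (m : R) * hu
  rw [e, mul_pow, sub_mul_pow_eq hp3 hu hh (hw (m + j + 1) (by omega) (by omega))]
  ring

/-- For `k > rm` the numerator contains the factor `1 - 1/n + rm = p (1 - 1/n)`, and `n ≥ 3`. -/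
theorem prod_pow_eq_zero_of_lt {R : Type*} [CommRing R] {m r p k : ℕ} {w : ℕ → R} {u : R}
    (hr : 2 ≤ r) (hp : p = r * m + m + 1) (hp3 : (p : R) ^ 3 = 0)
    (hu : ((r + 1 : ℕ) : R) * u = 1) (hk : r * m < k) :
    (∏ j ∈ Finset.range k, (1 - u + j) * w (j + 1)) ^ (r + 1) = 0 := by
  have hd : (p : R) ∣ ∏ j ∈ Finset.range k, (1 - u + j) * w (j + 1) := by
    refine dvd_trans ?_ (Finset.dvd_prod_of_mem _ (Finset.mem_range.mpr hk))
    refine Dvd.dvd.mul_right ⟨1 - u, ?_⟩ _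
    rw [hp]; push_cast at hu ⊢
    linear_combination (m : R) * hu
  obtain ⟨c, hc⟩ := hd
  rw [hc, mul_pow, pow_eq_zero_of_le (by omega : 3 ≤ r + 1) hp3, zero_mul]

/-- Evaluation of the truncated series modulo `p³`, with `u = 1/n` and `h = 1/2`. -/
theorem ZMod.factorial_pow_mul_sum_prod_pow_eq {p m r : ℕ} [Fact p.Prime] (h5 : 5 ≤ p)
    {w : ℕ → ZMod (p ^ 3)} {u h : ZMod (p ^ 3)} (hr : 2 ≤ r) (hp : p = r * m + m + 1)
    (hw : ∀ j, 0 < j → j < p → (j : ZMod (p ^ 3)) * w j = 1)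
    (hu : ((r + 1 : ℕ) : ZMod (p ^ 3)) * u = 1) (hh : 2 * h = 1) :
    (m.factorial : ZMod (p ^ 3)) ^ r * ∑ k ∈ Finset.range p,
      (∏ j ∈ Finset.range k, (1 - u + (j : ZMod (p ^ 3))) * w (j + 1)) ^ (r + 1) =
      (-1) ^ (r * m) * ((r * m).factorial : ZMod (p ^ 3)) *
        (1 - (p : ZMod (p ^ 3)) ^ 2 * ((1 - u) * h * harmonicSq w m)) := by
  have hp3 : (p : ZMod (p ^ 3)) ^ 3 = 0 := by rw [← Nat.cast_pow, ZMod.natCast_self]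
  have hS : ∑ k ∈ Finset.range p, (∏ j ∈ Finset.range k, (1 - u + (j : ZMod (p ^ 3))) * w (j + 1)) ^ (r + 1) =
      ∑ k ∈ Finset.range (r * m + 1), mintonWeight (ZMod (p ^ 3)) m r k * (1 +
        (p : ZMod (p ^ 3)) ^ 2 * ((1 - u) * h * (harmonicSq w (k + m) - harmonicSq w m))) := by
    rw [← Finset.sum_subset (s₁ := Finset.range (r * m + 1))]
    · refine Finset.sum_congr rfl fun k hk => ?_
      rw [Finset.mem_range] at hk
      exact prod_pow_eq_mintonWeight_mul hp hw hp3 hu hh (by omega)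
    · exact Finset.range_subset_range.mpr (by omega)
    · intro k _ hk
      rw [Finset.mem_range] at hk
      exact prod_pow_eq_zero_of_lt hr hp hp3 hu (by omega)
  -- With `y = -(1 - u) / 4` the Karlsson–Minton sum differs from the series, up to a multiple of the
  -- undeformed sum, by a combination of `H (k + m) + H k`, which vanishes by symmetry.
  have h1 := factorial_pow_mul_sum_mintonWeight_eq hr hp hw hp3 (-((1 - u) * h * h))
  have h0 := factorial_pow_mul_sum_mintonWeight_eq hr hp hw hp3 0
  have h2 := ZMod.sq_mul_sum_mintonWeight_mul_harmonicSq_eq_zero h5 hp hw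
  rw [hS]
  have key : ∑ k ∈ Finset.range (r * m + 1), mintonWeight (ZMod (p ^ 3)) m r k * (1 +
        (p : ZMod (p ^ 3)) ^ 2 * ((1 - u) * h * (harmonicSq w (k + m) - harmonicSq w m))) =
      ∑ k ∈ Finset.range (r * m + 1), mintonWeight (ZMod (p ^ 3)) m r k *
        (1 - (p : ZMod (p ^ 3)) ^ 2 * (-((1 - u) * h * h)) *
          (harmonicSq w (k + m) - harmonicSq w k)) +
      (1 - u) * h * h * ((p : ZMod (p ^ 3)) ^ 2 * ∑ k ∈ Finset.range (r * m + 1),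
        mintonWeight (ZMod (p ^ 3)) m r k * (harmonicSq w (k + m) + harmonicSq w k)) -
      (p : ZMod (p ^ 3)) ^ 2 * ((1 - u) * h * harmonicSq w m) *
        ∑ k ∈ Finset.range (r * m + 1), mintonWeight (ZMod (p ^ 3)) m r k *
        (1 - (p : ZMod (p ^ 3)) ^ 2 * 0 * (harmonicSq w (k + m) - harmonicSq w k)) := by
    simp only [Finset.mul_sum]
    rw [← Finset.sum_add_distrib, ← Finset.sum_sub_distrib]
    refine Finset.sum_congr rfl fun k _ => ?_
    linear_combination (-(mintonWeight (ZMod (p ^ 3)) m r k * (p : ZMod (p ^ 3)) ^ 2 *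
      (1 - u) * h * harmonicSq w (k + m))) * hh
  rw [key, h2]
  linear_combination h1 - (p : ZMod (p ^ 3)) ^ 2 * ((1 - u) * h * harmonicSq w m) * h0

/-! ### Values of the Gamma function at natural numbers -/

/-- The factor by which Morita's Gamma function changes from `i` to `i + 1`: it is `-i` if `i` is
prime to `p` and `-1` otherwise. The value is taken in an arbitrary ring, for reductions modulo
powers of `p`. -/
def gammaFactor (R : Type*) [CommRing R] (p i : ℕ) : R :=
  if i.Coprime p then -(i : R) else -1

/-- Morita's `Γ_p(a)` at a natural number `a`, as an element of `R`. -/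
def gammaProd (R : Type*) [CommRing R] (p a : ℕ) : R :=
  ∏ i ∈ Finset.range a, gammaFactor R p i

theorem map_gammaProd {R K : Type*} [CommRing R] [CommRing K] (φ : R →+* K) (p a : ℕ) :
    φ (gammaProd R p a) = gammaProd K p a := by
  simp only [gammaProd, map_prod, gammaFactor, apply_ite φ, map_neg, map_natCast, map_one]

theorem padicGammaNat_eq_gammaProd (p : ℕ) [Fact p.Prime] (a : ℕ) :
    padicGammaNat p a = gammaProd ℤ_[p] p a := by
  have h0 : ¬ Nat.Coprime 0 p := by
    rw [Nat.coprime_zero_left]; exact (Fact.out : p.Prime).ne_one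
  have hf : (Finset.Ico 1 a).filter (fun k => k.Coprime p) =
      (Finset.range a).filter (fun k => k.Coprime p) := by
    ext k
    simp only [Finset.mem_filter, Finset.mem_Ico, Finset.mem_range]
    refine ⟨fun h => ⟨h.1.2, h.2⟩, fun h => ⟨⟨Nat.pos_of_ne_zero ?_, h.1⟩, h.2⟩⟩
    rintro rfl
    exact h0 h.2
  have h1 : (-1 : ℤ_[p]) ^ a = ∏ i ∈ Finset.range a, (-1 : ℤ_[p]) := by simp
  rw [padicGammaNat, hf, Finset.prod_filter, h1, ← Finset.prod_mul_distrib, gammaProd]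
  refine Finset.prod_congr rfl fun i _ => ?_
  rw [gammaFactor]
  split_ifs <;> simp

theorem coprime_mul_add_iff {p i j : ℕ} : (p * i + j).Coprime p ↔ j.Coprime p := by
  rw [Nat.coprime_mul_left_add_left]

theorem prod_gammaFactor_block {R : Type*} [CommRing R] {p : ℕ} [Fact p.Prime] (hp : Odd p)
    (i : ℕ) : ∏ j ∈ Finset.range p, gammaFactor R p (p * i + j) =
      -∏ j ∈ Finset.range (p - 1), ((p * i + j + 1 : ℕ) : R) := by
  have hpr := (Fact.out : p.Prime)
  obtain ⟨q, hq⟩ := hp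
  have hr : Finset.range p = Finset.range (p - 1 + 1) := by rw [Nat.sub_add_cancel hpr.one_le]
  have h0 : gammaFactor R p (p * i + 0) = -1 := by
    rw [gammaFactor, if_neg]
    rw [coprime_mul_add_iff, Nat.coprime_zero_left]
    exact hpr.ne_one
  have h1 : ∏ j ∈ Finset.range (p - 1), gammaFactor R p (p * i + (j + 1)) =
      ∏ j ∈ Finset.range (p - 1), (-1 * ((p * i + j + 1 : ℕ) : R)) := by
    refine Finset.prod_congr rfl fun j hj => ?_
    rw [Finset.mem_range] at hj
    rw [gammaFactor, if_pos]
    · push_cast; ring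
    · rw [coprime_mul_add_iff]
      exact (hpr.coprime_iff_not_dvd.mpr
        (Nat.not_dvd_of_pos_of_lt (by omega) (by omega))).symm
  rw [hr, Finset.prod_range_succ', h0, h1, Finset.prod_mul_distrib, Finset.prod_const,
    Finset.card_range, show p - 1 = 2 * q by omega, pow_mul]
  simp

theorem prod_range_mul_eq {M : Type*} [CommMonoid M] (f : ℕ → M) (a b : ℕ) :
    ∏ i ∈ Finset.range (a * b), f i =
      ∏ c ∈ Finset.range b, ∏ k ∈ Finset.range a, f (a * c + k) := by
  induction b with
  | zero => simp
  | succ b ih => rw [Nat.mul_succ, Finset.prod_range_add, ih, Finset.prod_range_succ]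

theorem exists_mul_eq_one_of_coprime {R : Type*} [CommRing R] {p k : ℕ} (s : ℕ)
    (hp : (p : R) ^ s = 0) (hk : k.Coprime p) : ∃ w : R, (k : R) * w = 1 := by
  have h := Nat.isCoprime_iff_coprime.mpr (hk.pow_right s)
  obtain ⟨a, b, hab⟩ := h
  refine ⟨(a : R), ?_⟩
  have := congrArg (Int.cast (R := R)) hab
  push_cast at this
  rw [hp] at this
  linear_combination this

/-! ### Wilson's theorem modulo prime powers -/

/-- Induction step for Wilson's theorem modulo `p ^ s`: cut the product into `p` blocks of length
`p ^ (s + 1)`. The block number `c` is `A (1 + c p ^ (s + 1) B)` with `B` independent of `c`, and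
`∑ c` is divisible by the odd prime `p`, so the product is `A ^ p`. -/
theorem gammaProd_prime_pow_succ {R : Type*} [CommRing R] {p : ℕ} (hp : Odd p) {s : ℕ}
    (hpR : (p : R) ^ (s + 2) = 0) {t : R}
    (ht : gammaProd R p (p ^ (s + 1)) = 1 + (p : R) ^ (s + 1) * t) :
    gammaProd R p (p ^ (s + 2)) = 1 := by
  set z : R := (p : R) ^ (s + 1) with hz
  have hzz : z * z = 0 := by
    rw [hz, ← pow_add]
    exact pow_eq_zero_of_le (by omega) hpR
  have hpz : z * p = 0 := by rw [hz, ← pow_succ, hpR]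
  have hw : ∀ k : ℕ, ∃ w : R, k.Coprime p → (k : R) * w = 1 := fun k => by
    by_cases hk : k.Coprime p
    · obtain ⟨w, h⟩ := exists_mul_eq_one_of_coprime _ hpR hk
      exact ⟨w, fun _ => h⟩
    · exact ⟨0, fun h => absurd h hk⟩
  choose w hw using hw
  have hblock (c : ℕ) : ∏ k ∈ Finset.range (p ^ (s + 1)),
      gammaFactor R p (p ^ (s + 1) * c + k) = gammaProd R p (p ^ (s + 1)) *
        (1 + z * (c * ∑ k ∈ Finset.range (p ^ (s + 1)), if k.Coprime p then w k else 0)) := by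
    rw [Finset.mul_sum, ← prod_one_add_mul_of_mul_self_eq_zero hzz, gammaProd,
      ← Finset.prod_mul_distrib]
    refine Finset.prod_congr rfl fun k _ => ?_
    have hiff : (p ^ (s + 1) * c + k).Coprime p ↔ k.Coprime p := by
      rw [pow_succ', mul_assoc, coprime_mul_add_iff]
    simp only [gammaFactor, hiff]
    split_ifs with hk
    · rw [Nat.cast_add, Nat.cast_mul, Nat.cast_pow, ← hz]
      linear_combination (z * c) * hw k hk
    · simp
  have hsum : z * ∑ c ∈ Finset.range p, (c : R) = 0 := by
    have h2 := Finset.sum_range_id_mul_two p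
    obtain ⟨q, hq⟩ := hp
    have h3 : ∑ c ∈ Finset.range p, c = p * q := by
      have : p - 1 = 2 * q := by omega
      rw [this] at h2
      linarith
    rw [← Nat.cast_sum, h3, Nat.cast_mul, ← mul_assoc, hpz, zero_mul]
  rw [gammaProd, show p ^ (s + 2) = p ^ (s + 1) * p from pow_succ _ _, prod_range_mul_eq]
  simp only [hblock]
  rw [Finset.prod_mul_distrib, prod_one_add_mul_of_mul_self_eq_zero hzz, ← Finset.sum_mul,
    ← mul_assoc, hsum, zero_mul, add_zero, mul_one, ht,
    prod_one_add_mul_of_mul_self_eq_zero hzz, Finset.sum_const, Finset.card_range,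
    nsmul_eq_mul, ← mul_assoc, hpz, zero_mul, add_zero]

/-- Wilson's theorem modulo prime powers, in the form `Γ_p(p ^ s) ≡ 1 (mod p ^ s)`. -/
theorem gammaProd_prime_pow {p : ℕ} [Fact p.Prime] (hp : Odd p) (s : ℕ) :
    gammaProd (ZMod (p ^ (s + 1))) p (p ^ (s + 1)) = 1 := by
  induction s with
  | zero =>
    rw [zero_add, pow_one]
    have h := prod_gammaFactor_block (R := ZMod p) hp 0
    simp only [mul_zero, zero_add] at h
    rw [gammaProd, h, ← Nat.cast_prod, Finset.prod_range_add_one_eq_factorial, ZMod.wilsons_lemma,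
      neg_neg]
  | succ s ih =>
    have h1 : ((gammaProd ℤ p (p ^ (s + 1)) - 1 : ℤ) : ZMod (p ^ (s + 1))) = 0 := by
      rw [Int.cast_sub, Int.cast_one, ← eq_intCast (Int.castRingHom (ZMod (p ^ (s + 1)))),
        map_gammaProd, ih, sub_self]
    rw [ZMod.intCast_zmod_eq_zero_iff_dvd] at h1
    obtain ⟨t, ht⟩ := h1
    refine gammaProd_prime_pow_succ hp (t := (t : ZMod (p ^ (s + 1 + 1)))) ?_ ?_
    · rw [← Nat.cast_pow, ZMod.natCast_self]
    · rw [← map_gammaProd (Int.castRingHom (ZMod (p ^ (s + 1 + 1)))), eq_add_of_sub_eq ht]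
      simp [add_comm]

theorem gammaProd_add_prime_pow_mul {p : ℕ} [Fact p.Prime] (hp : Odd p) (s a c : ℕ) :
    gammaProd (ZMod (p ^ (s + 1))) p (p ^ (s + 1) * c + a) =
      gammaProd (ZMod (p ^ (s + 1))) p a := by
  induction c with
  | zero => simp
  | succ c ih =>
    rw [show p ^ (s + 1) * (c + 1) + a = p ^ (s + 1) + (p ^ (s + 1) * c + a) by ring, ← ih,
      gammaProd, Finset.prod_range_add, ← gammaProd, gammaProd_prime_pow hp, one_mul, gammaProd]
    refine Finset.prod_congr rfl fun i _ => ?_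
    have hiff : (p ^ (s + 1) + i).Coprime p ↔ i.Coprime p := by
      rw [show p ^ (s + 1) + i = p * p ^ s + i by ring, coprime_mul_add_iff]
    simp only [gammaFactor, hiff, Nat.cast_add, ZMod.natCast_self, zero_add]

theorem pow_dvd_padicGammaNat_sub {p : ℕ} [Fact p.Prime] (hp : Odd p) {s a b : ℕ} (hba : b ≤ a)
    (h : p ^ s ∣ a - b) : (p : ℤ_[p]) ^ s ∣ padicGammaNat p a - padicGammaNat p b := by
  cases s with
  | zero => simp
  | succ s =>
    obtain ⟨c, hc⟩ := h
    rw [← Ideal.mem_span_singleton, ← PadicInt.ker_toZModPow, RingHom.mem_ker, map_sub,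
      padicGammaNat_eq_gammaProd, padicGammaNat_eq_gammaProd, map_gammaProd, map_gammaProd,
      show a = p ^ (s + 1) * c + b by omega, gammaProd_add_prime_pow_mul hp, sub_self]

/-! ### The Gamma function on the `p`-adic integers -/

/-- For odd `p`, Morita's Gamma function is `1`-Lipschitz on the natural numbers. -/
theorem norm_padicGammaNat_sub_le {p : ℕ} [Fact p.Prime] (hp : Odd p) (a b : ℕ) :
    ‖padicGammaNat p a - padicGammaNat p b‖ ≤ ‖(a : ℤ_[p]) - b‖ := by
  wlog hba : b ≤ a generalizing a b
  · rw [norm_sub_rev, norm_sub_rev (a : ℤ_[p])]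
    exact this b a (by omega)
  rcases hba.eq_or_lt with rfl | hlt
  · simp
  have hne : (a : ℤ_[p]) - b ≠ 0 := by
    rw [sub_ne_zero]
    exact_mod_cast hlt.ne'
  rw [PadicInt.norm_eq_zpow_neg_valuation hne, PadicInt.norm_le_pow_iff_mem_span_pow,
    Ideal.mem_span_singleton]
  refine pow_dvd_padicGammaNat_sub hp hba ?_
  have h := (PadicInt.norm_le_pow_iff_mem_span_pow _ _).mp
    (PadicInt.norm_eq_zpow_neg_valuation hne).le
  rw [Ideal.mem_span_singleton, ← Nat.cast_sub hba] at h
  have h2 := (PadicInt.pow_p_dvd_int_iff (p := p) ((a : ℤ_[p]) - b).valuation ((a - b : ℕ) : ℤ)).mp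
    (by rw [Int.cast_natCast, Nat.cast_sub hba]; rwa [← Nat.cast_sub hba])
  exact_mod_cast h2

/-- In particular the limit defining `padicGamma` exists: the Lipschitz bound makes the image filter
Cauchy. -/
theorem norm_padicGamma_sub_padicGammaNat_le {p : ℕ} [Fact p.Prime] (hp : Odd p) (x : ℤ_[p])
    (a : ℕ) : ‖padicGamma p x - padicGammaNat p a‖ ≤ ‖x - a‖ := by
  set l := comap (fun n : ℕ => (n : ℤ_[p])) (𝓝 x) with hl
  have hne : l.NeBot := by
    refine comap_neBot fun t ht => ?_
    obtain ⟨_, ⟨n, rfl⟩, hn⟩ := (PadicInt.denseRange_natCast (p := p)).inter_nhds_nonempty ht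
    exact ⟨n, hn⟩
  have hcast : Tendsto (fun n : ℕ => (n : ℤ_[p])) l (𝓝 x) := tendsto_comap
  have hlim : Tendsto (padicGammaNat p) l (𝓝 (padicGamma p x)) := by
    refine tendsto_nhds_limUnder (cauchy_map_iff_exists_tendsto.mp ?_)
    have hc : Cauchy (map (fun n : ℕ => (n : ℤ_[p])) l) := hcast.cauchy_map
    rw [Metric.cauchy_iff] at hc ⊢
    refine ⟨inferInstance, fun ε hε => ?_⟩
    obtain ⟨t, ht, h⟩ := hc.2 ε hε
    refine ⟨_, image_mem_map (mem_map.mp ht), ?_⟩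
    rintro _ ⟨a, ha, rfl⟩ _ ⟨b, hb, rfl⟩
    have := h _ ha _ hb
    rw [dist_eq_norm] at this ⊢
    exact (norm_padicGammaNat_sub_le hp a b).trans_lt this
  exact le_of_tendsto_of_tendsto' (hlim.sub_const _).norm (hcast.sub_const _).norm
    fun b => norm_padicGammaNat_sub_le hp b a

theorem pow_dvd_padicGamma_sub {p : ℕ} [Fact p.Prime] (hp : Odd p) {x : ℤ_[p]} {a s : ℕ}
    (h : (p : ℤ_[p]) ^ s ∣ x - a) : (p : ℤ_[p]) ^ s ∣ padicGamma p x - padicGammaNat p a := by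
  rw [← Ideal.mem_span_singleton, ← PadicInt.norm_le_pow_iff_mem_span_pow] at h ⊢
  exact (norm_padicGamma_sub_padicGammaNat_le hp x a).trans h

/-! ### The Gamma function at `1 / n` modulo `p³` -/

theorem ZMod.isUnit_natCast_pow_of_ne_zero {p : ℕ} [Fact p.Prime] {a : ℕ} (h : (a : ZMod p) ≠ 0) (s : ℕ) :
    IsUnit (a : ZMod (p ^ s)) := by
  rw [ZMod.isUnit_iff_coprime]
  refine Nat.Coprime.pow_right _ (Nat.Coprime.symm ?_)
  rw [(Fact.out : p.Prime).coprime_iff_not_dvd]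
  rwa [Ne, ZMod.natCast_eq_zero_iff] at h

/-- A form of Wolstenholme's theorem: `(px + 1) ⋯ (px + p - 1) ≡ (p - 1)! (mod p³)`. Pairing `j` with
`p - j` shows that the squares agree, since `∑ j⁻² ≡ 0 (mod p)`; both sides are congruent to the same
unit modulo the odd prime `p`, so they agree. -/
theorem ZMod.prod_mul_add_eq_factorial {p : ℕ} [Fact p.Prime] (h5 : 5 ≤ p)
    {w : ℕ → ZMod (p ^ 3)} (hw : ∀ j, 0 < j → j < p → (j : ZMod (p ^ 3)) * w j = 1) (x : ℕ) :
    ∏ j ∈ Finset.range (p - 1), ((p * x + j + 1 : ℕ) : ZMod (p ^ 3)) =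
      ((p - 1).factorial : ZMod (p ^ 3)) := by
  have hpr := (Fact.out : p.Prime)
  have hp3 : (p : ZMod (p ^ 3)) ^ 3 = 0 := by rw [← Nat.cast_pow, ZMod.natCast_self]
  have hz : (p : ZMod (p ^ 3)) ^ 2 * (p : ZMod (p ^ 3)) ^ 2 = 0 := by
    linear_combination (p : ZMod (p ^ 3)) * hp3
  let φ := ZMod.castHom (dvd_pow_self p three_ne_zero) (ZMod p)
  have hf : ((p - 1).factorial : ZMod (p ^ 3)) =
      ∏ j ∈ Finset.range (p - 1), ((j + 1 : ℕ) : ZMod (p ^ 3)) := by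
    rw [← Nat.cast_prod, Finset.prod_range_add_one_eq_factorial]
  have hzero : (p : ZMod (p ^ 3)) ^ 2 *
      ∑ j ∈ Finset.range (p - 1), w (j + 1) * w (p - 1 - j) = 0 := by
    apply ZMod.sq_mul_eq_zero_of_castHom_eq_zero
    rw [map_sum, ← neg_zero, ← harmonicSq_sub_one_eq_zero h5 (map_inverse_family φ hw), harmonicSq,
      ← Finset.sum_neg_distrib]
    refine Finset.sum_congr rfl fun j hj => ?_
    rw [Finset.mem_range] at hj
    have := inverse_family_eq_neg (map_inverse_family φ hw) (i := p - 1 - j) (j := j + 1)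
      (by omega) (by omega) (by omega)
    rw [map_mul]
    linear_combination φ (w (j + 1)) * this
  have hsq : (∏ j ∈ Finset.range (p - 1), ((p * x + j + 1 : ℕ) : ZMod (p ^ 3))) ^ 2 =
      ((p - 1).factorial : ZMod (p ^ 3)) ^ 2 := by
    have hfac : ((p - 1).factorial : ZMod (p ^ 3)) ^ 2 = ((p - 1).factorial : ZMod (p ^ 3)) ^ 2 *
        ∏ j ∈ Finset.range (p - 1),
          (1 + (p : ZMod (p ^ 3)) ^ 2 * (((x : ZMod (p ^ 3)) ^ 2 + x) *
            (w (j + 1) * w (p - 1 - j)))) := by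
      rw [prod_one_add_mul_of_mul_self_eq_zero hz, ← Finset.mul_sum, mul_left_comm, hzero]
      ring
    rw [hfac, hf, sq, sq]
    nth_rw 2 [← Finset.prod_range_reflect]
    nth_rw 4 [← Finset.prod_range_reflect]
    simp only [← Finset.prod_mul_distrib]
    refine Finset.prod_congr rfl fun j hj => ?_
    rw [Finset.mem_range] at hj
    have h1 := hw (j + 1) (by omega) (by omega)
    have h2 := hw (p - 1 - j) (by omega) (by omega)
    rw [show p - 1 - 1 - j + 1 = p - 1 - j by omega,
      show p * x + (p - 1 - 1 - j) + 1 = p * x + (p - 1 - j) by omega]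
    have h3 : ((p - 1 - j : ℕ) : ZMod (p ^ 3)) = p - (j + 1 : ℕ) := by
      rw [show p - 1 - j = p - (j + 1) by omega, Nat.cast_sub (by omega)]
    rw [h3] at h2 ⊢
    push_cast at h1 h2 ⊢
    rw [h3]
    push_cast
    generalize w (j + 1) = W at *
    generalize w (p - 1 - j) = V at *
    linear_combination (-(p : ZMod (p ^ 3)) ^ 2 * ((x : ZMod (p ^ 3)) ^ 2 + x)) *
      (h1 * ((p : ZMod (p ^ 3)) - ((j : ZMod (p ^ 3)) + 1)) * V + h2)
  have hunit : IsUnit (∏ j ∈ Finset.range (p - 1), ((p * x + j + 1 : ℕ) : ZMod (p ^ 3)) +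
      ((p - 1).factorial : ZMod (p ^ 3))) := by
    rw [← Nat.cast_prod, ← Nat.cast_add]
    apply ZMod.isUnit_natCast_pow_of_ne_zero
    rw [Nat.cast_add, Nat.cast_prod]
    have : ∏ j ∈ Finset.range (p - 1), ((p * x + j + 1 : ℕ) : ZMod p) =
        ((p - 1).factorial : ZMod p) := by
      rw [← Finset.prod_range_add_one_eq_factorial, Nat.cast_prod]
      exact Finset.prod_congr rfl fun j _ => by simp
    rw [this, ← two_mul, ZMod.wilsons_lemma]
    intro h
    have : ((2 : ℕ) : ZMod p) = 0 := by push_cast; linear_combination -h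
    rw [ZMod.natCast_eq_zero_iff] at this
    have := Nat.le_of_dvd (by norm_num) this
    omega
  refine sub_eq_zero.mp (hunit.mul_left_cancel ?_)
  linear_combination hsq

theorem ZMod.gammaProd_prime_mul {p : ℕ} [Fact p.Prime] (h5 : 5 ≤ p) {w : ℕ → ZMod (p ^ 3)}
    (hw : ∀ j, 0 < j → j < p → (j : ZMod (p ^ 3)) * w j = 1) (b : ℕ) :
    gammaProd (ZMod (p ^ 3)) p (p * b) = (-((p - 1).factorial : ZMod (p ^ 3))) ^ b := by
  have hp : Odd p := (Fact.out : p.Prime).odd_of_ne_two (by omega)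
  rw [gammaProd, prod_range_mul_eq]
  simp only [prod_gammaFactor_block hp, ZMod.prod_mul_add_eq_factorial h5 hw]
  simp

theorem ZMod.neg_factorial_pow_eq {p : ℕ} [Fact p.Prime] (t : ℕ) :
    (-((p - 1).factorial : ZMod (p ^ 3))) ^ (p ^ 3 * t + 1) =
      -((p - 1).factorial : ZMod (p ^ 3)) := by
  have h1 : (p : ℤ) ∣ -((p - 1).factorial : ℤ) - 1 := by
    rw [← ZMod.intCast_zmod_eq_zero_iff_dvd]
    push_cast
    rw [ZMod.wilsons_lemma]
    ring
  have h2 := dvd_sub_pow_of_dvd_sub h1 3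
  have h3 : (-((p - 1).factorial : ZMod (p ^ 3))) ^ (p ^ 3) = 1 := by
    have h4 : ((p ^ 3 : ℕ) : ℤ) ∣ (-((p - 1).factorial : ℤ)) ^ p ^ 3 - 1 ^ p ^ 3 := by
      refine dvd_trans ?_ h2
      rw [Nat.cast_pow]
      exact pow_dvd_pow _ (by norm_num)
    rw [← ZMod.intCast_zmod_eq_zero_iff_dvd] at h4
    push_cast at h4
    rw [one_pow] at h4
    exact sub_eq_zero.mp h4
  rw [pow_add, pow_mul, h3, one_pow, one_mul, pow_one]

/-- Evaluation of `Γ_p(a)^n` modulo `p³`, where `n = r + 1`, `b ≡ 1/n` and `a = pb - m ≡ 1/n`: the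
functional equation gives `Γ_p(pb) = Γ_p(a) ∏_{j=1}^m (j - pb)`, and
`Γ_p(pb)^n ≡ (-(p - 1)!)^(nb) = -(p - 1)!`. -/
theorem ZMod.factorial_pow_mul_gammaProd_pow_eq {p m r a b t : ℕ} [Fact p.Prime] (h5 : 5 ≤ p)
    {w : ℕ → ZMod (p ^ 3)} {h : ZMod (p ^ 3)} (hp : p = r * m + m + 1)
    (hw : ∀ j, 0 < j → j < p → (j : ZMod (p ^ 3)) * w j = 1) (hh : 2 * h = 1)
    (hb : (r + 1) * b = p ^ 3 * t + 1) (ha : a + m = p * b) :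
    (m.factorial : ZMod (p ^ 3)) ^ r * gammaProd (ZMod (p ^ 3)) p a ^ (r + 1) *
      (1 + (p : ZMod (p ^ 3)) ^ 2 * ((1 - (b : ZMod (p ^ 3))) * h * harmonicSq w m)) =
      -((-1) ^ m * ((r * m).factorial : ZMod (p ^ 3))) := by
  have hpr := (Fact.out : p.Prime)
  have hp3 : (p : ZMod (p ^ 3)) ^ 3 = 0 := by rw [← Nat.cast_pow, ZMod.natCast_self]
  have hz : (p : ZMod (p ^ 3)) ^ 2 * (p : ZMod (p ^ 3)) ^ 2 = 0 := by
    linear_combination (p : ZMod (p ^ 3)) * hp3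
  have hu : ((r + 1 : ℕ) : ZMod (p ^ 3)) * (b : ZMod (p ^ 3)) = 1 := by
    rw [← Nat.cast_mul, hb]; simp
  have hG : gammaProd (ZMod (p ^ 3)) p a *
      ∏ j ∈ Finset.range m, (((j + 1 : ℕ) : ZMod (p ^ 3)) - p * b) =
      (-((p - 1).factorial : ZMod (p ^ 3))) ^ b := by
    rw [← ZMod.gammaProd_prime_mul h5 hw, ← ha, gammaProd, gammaProd, Finset.prod_range_add,
      ← Finset.prod_range_reflect (fun j => gammaFactor (ZMod (p ^ 3)) p (a + j))]
    congr 1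
    refine Finset.prod_congr rfl fun j hj => ?_
    rw [Finset.mem_range] at hj
    have e : a + (m - 1 - j) + (j + 1) = p * b := by omega
    have hc : (a + (m - 1 - j)).Coprime p := by
      rw [Nat.coprime_comm, hpr.coprime_iff_not_dvd]
      intro hd
      have h1 : p ∣ j + 1 := (Nat.dvd_add_right hd).mp (e ▸ dvd_mul_right p b)
      have := Nat.le_of_dvd (by omega) h1
      omega
    have e' := congrArg (Nat.cast (R := ZMod (p ^ 3))) e
    rw [gammaFactor, if_pos hc]
    push_cast at e' ⊢
    linear_combination e'
  have hD : ∏ j ∈ Finset.range m, (((j + 1 : ℕ) : ZMod (p ^ 3)) - p) =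
      (-1) ^ m * ((p - 1).descFactorial m : ZMod (p ^ 3)) := by
    have : ((-1 : ZMod (p ^ 3))) ^ m = ∏ j ∈ Finset.range m, (-1 : ZMod (p ^ 3)) := by simp
    rw [Nat.descFactorial_eq_prod_range, Nat.cast_prod, this, ← Finset.prod_mul_distrib]
    refine Finset.prod_congr rfl fun j hj => ?_
    rw [Finset.mem_range] at hj
    have e : p - 1 - j + (j + 1) = p := by omega
    have e' := congrArg (Nat.cast (R := ZMod (p ^ 3))) e
    push_cast at e' ⊢
    linear_combination e'
  have hP : (∏ j ∈ Finset.range m, (((j + 1 : ℕ) : ZMod (p ^ 3)) - p * b)) ^ (r + 1) =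
      (m.factorial : ZMod (p ^ 3)) ^ r * ((-1) ^ m * ((p - 1).descFactorial m : ZMod (p ^ 3))) *
        (1 + (p : ZMod (p ^ 3)) ^ 2 * ((1 - (b : ZMod (p ^ 3))) * h * harmonicSq w m)) := by
    have e1 : (1 + (p : ZMod (p ^ 3)) ^ 2 * ((1 - (b : ZMod (p ^ 3))) * h * harmonicSq w m)) =
        ∏ j ∈ Finset.range m, (1 + (p : ZMod (p ^ 3)) ^ 2 * ((1 - (b : ZMod (p ^ 3))) * h * w (j + 1) ^ 2)) := by
      rw [prod_one_add_mul_of_mul_self_eq_zero hz, harmonicSq, Finset.mul_sum]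
    rw [← hD, e1, ← Finset.prod_range_add_one_eq_factorial, Nat.cast_prod, ← Finset.prod_pow,
      ← Finset.prod_pow, ← Finset.prod_mul_distrib, ← Finset.prod_mul_distrib]
    refine Finset.prod_congr rfl fun j hj => ?_
    rw [Finset.mem_range] at hj
    exact sub_mul_pow_eq hp3 hu hh (hw (j + 1) (by omega) (by omega))
  have hfac : ((r * m).factorial : ZMod (p ^ 3)) * ((p - 1).descFactorial m : ZMod (p ^ 3)) =
      ((p - 1).factorial : ZMod (p ^ 3)) := by
    rw [← Nat.cast_mul, ← Nat.factorial_mul_descFactorial (by omega : m ≤ p - 1),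
      show p - 1 - m = r * m by omega]
  have hunit : IsUnit ((p - 1).descFactorial m : ZMod (p ^ 3)) := by
    have h1 := factorial_mul_prod_eq_one hw (k := p - 1) (by omega)
    rw [← hfac, mul_assoc, mul_left_comm] at h1
    exact IsUnit.of_mul_eq_one _ h1
  have hn := congrArg (· ^ (r + 1)) hG
  simp only [mul_pow, ← pow_mul] at hn
  rw [mul_comm b, hb, ZMod.neg_factorial_pow_eq, hP, ← hfac] at hn
  have hsgn : ((-1 : ZMod (p ^ 3)) ^ m) * (-1) ^ m = 1 := by rw [← mul_pow]; simp
  apply hunit.mul_left_cancel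
  linear_combination ((-1 : ZMod (p ^ 3)) ^ m) * hn - ((p - 1).descFactorial m *
    (m.factorial : ZMod (p ^ 3)) ^ r * gammaProd (ZMod (p ^ 3)) p a ^ (r + 1) *
    (1 + (p : ZMod (p ^ 3)) ^ 2 * ((1 - (b : ZMod (p ^ 3))) * h * harmonicSq w m))) * hsgn

/-! ### The supercongruence -/

theorem ascPochhammer_eval_eq_prod_range_add {S : Type*} [CommSemiring S] (k : ℕ) (x : S) :
    (ascPochhammer S k).eval x = ∏ j ∈ Finset.range k, (x + j) := by
  induction k with
  | zero => simp
  | succ k ih => rw [ascPochhammer_succ_eval, ih, Finset.prod_range_succ]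

theorem truncatedHypergeometric_one_eq_sum_pow {K : Type*} [Field K] (x : K) {r n : ℕ}
    (hn : n = r + 1) (m : ℕ) :
    truncatedHypergeometric (fun _ : Fin n => x) (fun _ : Fin (n - 1) => (1 : K)) 1 m =
      ∑ k ∈ Finset.range (m + 1),
        ((∏ j ∈ Finset.range k, (x + j)) / (k.factorial : K)) ^ (r + 1) := by
  subst hn
  rw [truncatedHypergeometric]
  refine Finset.sum_congr rfl fun k _ => ?_
  rw [ascPochhammer_eval_one]
  simp only [Finset.prod_const, Finset.card_univ, Fintype.card_fin,
    ascPochhammer_eval_eq_prod_range_add, Nat.add_sub_cancel, one_pow]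
  rw [div_pow, pow_succ (k.factorial : K), div_mul_div_comm, mul_one]

theorem PadicInt.exists_natCast_mul_eq_one {p k : ℕ} [Fact p.Prime] (hk : k.Coprime p) :
    ∃ v : ℤ_[p], (k : ℤ_[p]) * v = 1 := by
  have : IsUnit (k : ℤ_[p]) := by
    rw [PadicInt.isUnit_iff]
    exact PadicInt.norm_natCast_eq_one_iff.mpr hk.symm
  exact this.exists_right_inv

theorem theorem1p1 (n : ℕ) (hn : 3 ≤ n) (p : ℕ) [Fact p.Prime] (hp : p ≡ 1 [MOD n]) :
    ∃ F u : ℤ_[p],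
      (F : ℚ_[p]) = ((truncatedHypergeometric (fun _ : Fin n => ((n : ℚ) - 1) / n)
        (fun _ : Fin (n - 1) => (1 : ℚ)) 1 (p - 1) : ℚ) : ℚ_[p]) ∧
      (u : ℚ_[p]) = 1 / (n : ℚ_[p]) ∧
      (p : ℤ_[p]) ^ 3 ∣ F - (-(padicGamma p u ^ n)) := by
  have hpr := (Fact.out : p.Prime)
  obtain ⟨r, hr⟩ : ∃ r, n = r + 1 := ⟨n - 1, by omega⟩
  obtain ⟨m, hm⟩ := (Nat.modEq_iff_dvd' hpr.one_le).mp hp.symm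
  have hpm : p = r * m + m + 1 := by
    have : n * m = r * m + m := by rw [hr]; ring
    have := hpr.one_le
    omega
  have hm0 : 0 < m := by
    rcases Nat.eq_zero_or_pos m with rfl | h
    · exact absurd (by simpa using hpm) hpr.ne_one
    · exact h
  have hr2 : 2 ≤ r := by omega
  have h5 : 5 ≤ p := by
    have h4 : 2 * 1 ≤ r * m := Nat.mul_le_mul hr2 hm0
    have : p ≠ 4 := by rintro rfl; revert hpr; decide
    omega
  have hodd : Odd p := hpr.odd_of_ne_two (by omega)
  have hnp : n.Coprime p := by
    have h1 : Nat.gcd n p ∣ 1 := by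
      refine (Nat.dvd_add_right (b := n * m) ((Nat.gcd_dvd_left n p).mul_right m)).mp ?_
      rw [show n * m + 1 = p by have := hpr.one_le; omega]
      exact Nat.gcd_dvd_right n p
    exact Nat.dvd_one.mp h1
  have hv : ∀ j : ℕ, ∃ v : ℤ_[p], 0 < j → j < p → (j : ℤ_[p]) * v = 1 := fun j => by
    by_cases h : 0 < j ∧ j < p
    · obtain ⟨v, hv⟩ := PadicInt.exists_natCast_mul_eq_one
        (hpr.coprime_iff_not_dvd.mpr (Nat.not_dvd_of_pos_of_lt h.1 h.2)).symm
      exact ⟨v, fun _ _ => hv⟩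
    · exact ⟨0, fun h0 h1 => absurd ⟨h0, h1⟩ h⟩
  choose v hv using hv
  obtain ⟨u, hu⟩ := PadicInt.exists_natCast_mul_eq_one hnp
  obtain ⟨b, t, hb⟩ : ∃ b t, (r + 1) * b = p ^ 3 * t + 1 := by
    obtain ⟨b, -, hb⟩ := Nat.exists_mul_mod_eq_one_of_coprime (hnp.pow_right 3)
      (Nat.one_lt_pow (by norm_num) hpr.one_lt)
    refine ⟨b, n * b / p ^ 3, ?_⟩
    rw [← hr, ← hb, Nat.div_add_mod]
  have hb0 : 0 < b := Nat.pos_of_ne_zero (by rintro rfl; simp at hb)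
  obtain ⟨a, ha⟩ : ∃ a, a + m = p * b :=
    ⟨p * b - m, Nat.sub_add_cancel (le_trans (by omega) (Nat.le_mul_of_pos_right p hb0))⟩
  let φ : ℤ_[p] →+* ZMod (p ^ 3) := PadicInt.toZModPow 3
  have hw := map_inverse_family φ hv
  have hp3 : (p : ZMod (p ^ 3)) ^ 3 = 0 := by rw [← Nat.cast_pow, ZMod.natCast_self]
  have hbR : ((r + 1 : ℕ) : ZMod (p ^ 3)) * b = 1 := by
    rw [← Nat.cast_mul, hb]; simp
  have huR : ((r + 1 : ℕ) : ZMod (p ^ 3)) * φ u = 1 := by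
    rw [← map_natCast φ, ← map_mul, ← hr, hu, map_one]
  have hub : φ u = b := by linear_combination (b : ZMod (p ^ 3)) * huR - φ u * hbR
  have hua : φ u = a := by
    have e := congrArg (Nat.cast (R := ZMod (p ^ 3))) ha
    have e2 := congrArg (Nat.cast (R := ZMod (p ^ 3))) hpm
    have e3 : ((r + 1 : ℕ) : ZMod (p ^ 3)) * (a : ZMod (p ^ 3)) = 1 := by
      push_cast at e e2 hbR ⊢
      linear_combination ((r : ZMod (p ^ 3)) + 1) * e + (p : ZMod (p ^ 3)) * hbR + e2
    linear_combination (a : ZMod (p ^ 3)) * huR - φ u * e3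
  have hh := hw 2 (by norm_num) (by omega)
  rw [Nat.cast_ofNat] at hh
  refine ⟨∑ k ∈ Finset.range p, (∏ j ∈ Finset.range k, (1 - u + j) * v (j + 1)) ^ (r + 1), u,
    ?_, ?_, ?_⟩
  · have hnQ : (n : ℚ_[p]) ≠ 0 := by exact_mod_cast (by omega : n ≠ 0)
    have huQ : (n : ℚ_[p]) * (u : ℚ_[p]) = 1 := by exact_mod_cast congrArg (Subtype.val) hu
    rw [truncatedHypergeometric_one_eq_sum_pow _ hr, Nat.sub_add_cancel hpr.one_le]
    push_cast
    change PadicInt.Coe.ringHom _ = _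
    simp only [map_sum, map_pow, map_prod, map_mul, map_add, map_sub, map_one, map_natCast]
    change ∑ k ∈ Finset.range p, (∏ j ∈ Finset.range k,
      (1 - (u : ℚ_[p]) + j) * (v (j + 1) : ℚ_[p])) ^ (r + 1) = _
    refine Finset.sum_congr rfl fun k hk => ?_
    rw [Finset.mem_range] at hk
    have hf : (k.factorial : ℚ_[p]) ≠ 0 := by exact_mod_cast k.factorial_ne_zero
    have hv1 : (k.factorial : ℚ_[p]) * ∏ j ∈ Finset.range k, (v (j + 1) : ℚ_[p]) = 1 := by
      have := congrArg (PadicInt.Coe.ringHom (p := p)) (factorial_mul_prod_eq_one hv hk)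
      simp only [map_mul, map_prod, map_natCast, map_one] at this
      exact this
    congr 1
    rw [Finset.prod_mul_distrib, eq_div_iff hf, mul_assoc,
      mul_comm (∏ j ∈ Finset.range k, (v (j + 1) : ℚ_[p])), hv1, mul_one]
    refine Finset.prod_congr rfl fun j _ => ?_
    congr 1
    field_simp
    linear_combination -huQ
  · have hnQ : (n : ℚ_[p]) ≠ 0 := by exact_mod_cast (by omega : n ≠ 0)
    rw [eq_div_iff hnQ, mul_comm]
    exact_mod_cast congrArg (Subtype.val) hu
  · rw [← Ideal.mem_span_singleton, ← PadicInt.ker_toZModPow, RingHom.mem_ker]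
    change φ _ = 0
    have hΓ : φ (padicGamma p u) = gammaProd (ZMod (p ^ 3)) p a := by
      rw [← map_gammaProd φ, ← padicGammaNat_eq_gammaProd, ← sub_eq_zero, ← map_sub,
        ← RingHom.mem_ker, PadicInt.ker_toZModPow, Ideal.mem_span_singleton]
      apply pow_dvd_padicGamma_sub hodd
      rw [← Ideal.mem_span_singleton, ← PadicInt.ker_toZModPow, RingHom.mem_ker, map_sub,
        map_natCast, sub_eq_zero]
      exact hua
    simp only [map_add, map_sub, map_neg, map_pow, map_sum, map_prod, map_mul, map_one, map_natCast, hΓ,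
      hub, hr]
    have h1 := ZMod.factorial_pow_mul_sum_prod_pow_eq h5 hr2 hpm hw hbR hh
    have h2 := ZMod.factorial_pow_mul_gammaProd_pow_eq h5 hpm hw hh hb ha
    have hsgn : (-1 : ZMod (p ^ 3)) ^ m = (-1) ^ (r * m) := by
      have he : Even (r * m + m) := by
        obtain ⟨q, hq⟩ := hodd
        exact ⟨q, by omega⟩
      have h3 : (-1 : ZMod (p ^ 3)) ^ (r * m) * (-1) ^ m = 1 := by rw [← pow_add, he.neg_one_pow]
      have h4 : (-1 : ZMod (p ^ 3)) ^ m * (-1) ^ m = 1 := by rw [← mul_pow]; simp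
      linear_combination (-1 : ZMod (p ^ 3)) ^ (r * m) * h4 - (-1 : ZMod (p ^ 3)) ^ m * h3
    rw [hsgn] at h2
    have hfu : IsUnit ((m.factorial : ZMod (p ^ 3)) ^ r) :=
      (IsUnit.of_mul_eq_one _ (factorial_mul_prod_eq_one hw (k := m) (by omega))).pow r
    set E : ZMod (p ^ 3) := (p : ZMod (p ^ 3)) ^ 2 *
      ((1 - (b : ZMod (p ^ 3))) * φ (v 2) * harmonicSq (fun j => φ (v j)) m) with hE
    have hEE : (1 + E) * (1 - E) = 1 := by
      rw [hE]
      linear_combination (-(p : ZMod (p ^ 3)) * ((1 - (b : ZMod (p ^ 3))) * φ (v 2) *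
        harmonicSq (fun j => φ (v j)) m) ^ 2) * hp3
    refine (hfu.mul (IsUnit.of_mul_eq_one _ hEE)).mul_left_cancel ?_
    rw [mul_zero]
    linear_combination (1 + E) * h1 + h2 + ((-1) ^ (r * m) * ((r * m).factorial : ZMod (p ^ 3))) * hEE
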